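/- Let $(M,g)$ be a connected smooth Hausdorff Lorentzian $4$-manifold with Levi-Civita connection $\nabla$, carrying a smooth unit timelike field $u^a$, a smooth unit spacelike field $e^a$ orthogonal to it, and a smooth area form $\epsilon_{ab}$ of the sheet $\{u,e\}^\perp$; put $N_{ab}=g_{ab}+u_au_b-e_ae_b$. Assume the spacetime is locally rotationally symmetric (LRS): there are smooth functions $\mathcal A,\Theta,\Sigma,\Omega,\phi,\xi$ with vanishing gradient along the sheet such that $$\nabla_a u_b=-\mathcal A\,u_ae_b+(\tfrac13\Theta+\Sigma)e_ae_b+\Omega\,\epsilon_{ab}+(\tfrac13\Theta-\tfrac12\Sigma)N_{ab},$$ $$\nabla_a e_b=-\mathcal A\,u_au_b+(\tfrac13\Theta+\Sigma)e_au_b+\tfrac12\phi N_{ab}+\xi\,\epsilon_{ab}.$$ An LRS scalar is a smooth function $\Psi$ on $M$ with vanishing gradient along the sheet; write $\dot\Psi=u^a\nabla_a\Psi$ and $\hat\Psi=e^a\nabla_a\Psi$. Assume the spacetime is simultaneously rotating and twisting: $\Omega\xi\neq0$ everywhere. Then: 1. Every LRS scalar satisfies $\dot\Psi\,\Omega=\hat\Psi\,\xi$.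 Let moreover $\tau,\rho$ be curve parameters, i.e. smooth functions on $M$ with $d\tau,d\rho$ linearly independent at every point, such that every LRS scalar is locally a function $\Psi=\psi(\tau,\rho)$ with $\dot\Psi=\partial_\tau\psi$ and $\hat\Psi=\partial_\rho\psi$; assume $\rho\neq0$ everywhere and put $z=\tau/\rho$. An LRS scalar $\Psi$ has scaling weight $n\in\mathbb R$ if $\Psi(\tau,\rho)=a^n\Psi(a\tau,a\rho)$ for all $a>0$, that is, $\Psi(p)=a^n\Psi(q)$ whenever $p,q\in M$, $\tau(q)=a\tau(p)$ and $\rho(q)=a\rho(p)$; it is dimensionless if it has weight $0$. Then: 2. Every dimensionless LRS scalar is constant. 3. There are constants $A\neq0$, $B\neq0$ with $A\,\Omega=B\,\xi$ such that for every integer $n$ every LRS scalar $\Psi$ of scaling weight $n$ has the form $$\Psi=\frac{C_\Psi}{(Az+B)^n\rho^n}$$ with a constant $C_\Psi$. (At a possible point with $Az+B=0$ the right-hand side is read as $0$ when $n\neq0$, and as $C_\Psi$ when $n=0$.) 4. If $\Omega$ and $\xi$ have scaling weight $1$, then $A$ and $B$ in 3 can be chosen such that in addition $Az+B\neq0$ everywhere,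 $$\xi=-\frac{1}{(Az+B)\rho},\qquad \Omega=-\frac{B}{A(Az+B)\rho},$$ and for every real $n$ every LRS scalar of scaling weight $n$ has the form $C_\Psi/(|Az+B|^n|\rho|^n)$. -/

import Mathlib

open scoped Manifold ContDiff Topology

noncomputable section

namespace LRS

/-- The tangent space at a point of a 4-dimensional manifold. -/
abbrev T {M : Type*} [TopologicalSpace M] [ChartedSpace (EuclideanSpace ℝ (Fin 4)) M] (p : M) :
    Type :=
  TangentSpace (𝓡 4) p

/-- A (not necessarily smooth) vector field. -/
abbrev VField (M : Type*) [TopologicalSpace M] [ChartedSpace (EuclideanSpace ℝ (Fin 4)) M] :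
    Type _ :=
  (p : M) → TangentSpace (𝓡 4) p

/-- A (not necessarily smooth) covariant 2-tensor field. -/
abbrev TwoTensor (M : Type*) [TopologicalSpace M] [ChartedSpace (EuclideanSpace ℝ (Fin 4)) M] :
    Type _ :=
  (p : M) → TangentSpace (𝓡 4) p →L[ℝ] TangentSpace (𝓡 4) p →L[ℝ] ℝ

section Basic

variable {M : Type*} [TopologicalSpace M] [ChartedSpace (EuclideanSpace ℝ (Fin 4)) M]

/-- The derivative `v(f) = v^a ∇_a f` of a function `f` along a tangent vector `v` at `p`. -/
def dirDeriv (f : M → ℝ) (p : M) (v : T p) : ℝ :=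
  mfderiv (𝓡 4) 𝓘(ℝ, ℝ) f p v

variable [IsManifold (𝓡 4) ∞ M]

/-- A vector field is differentiable at `p`. -/
def VField.DiffAt (X : VField M) (p : M) : Prop :=
  MDifferentiableAt (𝓡 4) ((𝓡 4).prod 𝓘(ℝ, EuclideanSpace ℝ (Fin 4)))
    (fun q ↦ Bundle.TotalSpace.mk' (EuclideanSpace ℝ (Fin 4))
      (E := (TangentSpace (𝓡 4) : M → Type _)) q (X q)) p

/-- A vector field is smooth. -/
def VField.Smooth (X : VField M) : Prop :=
  ContMDiff (𝓡 4) ((𝓡 4).prod 𝓘(ℝ, EuclideanSpace ℝ (Fin 4))) ∞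
    (fun q ↦ Bundle.TotalSpace.mk' (EuclideanSpace ℝ (Fin 4))
      (E := (TangentSpace (𝓡 4) : M → Type _)) q (X q))

/-- A covariant 2-tensor field is smooth. -/
def TwoTensor.Smooth (t : TwoTensor M) : Prop :=
  ContMDiff (𝓡 4)
    ((𝓡 4).prod 𝓘(ℝ, EuclideanSpace ℝ (Fin 4) →L[ℝ] EuclideanSpace ℝ (Fin 4) →L[ℝ] ℝ)) ∞
    (fun q ↦ Bundle.TotalSpace.mk'
      (EuclideanSpace ℝ (Fin 4) →L[ℝ] EuclideanSpace ℝ (Fin 4) →L[ℝ] ℝ)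
      (E := fun q : M ↦ TangentSpace (𝓡 4) q →L[ℝ] TangentSpace (𝓡 4) q →L[ℝ] ℝ) q (t q))

/-- `g` is a smooth Lorentzian metric of signature `(-,+,+,+)`. -/
structure IsLorentzMetric (g : TwoTensor M) : Prop where
  smooth : TwoTensor.Smooth g
  symm : ∀ (p : M) (v w : T p), g p v w = g p w v
  signature : ∀ p : M, ∃ b : Module.Basis (Fin 4) ℝ (T p), ∀ i j : Fin 4,
    g p (b i) (b j) = if i = j then (if i = 0 then -1 else 1) else 0

/-- `nab` is the Levi-Civita connection of `g`: it is torsion free and metric.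
(`nab Y p v` is `∇_v Y` at `p`.) -/
structure IsLeviCivita (g : TwoTensor M)
    (nab : CovariantDerivative (𝓡 4) (EuclideanSpace ℝ (Fin 4))
      (TangentSpace (𝓡 4) : M → Type _)) : Prop where
  torsionFree : ∀ (X Y : VField M) (p : M), X.DiffAt p → Y.DiffAt p →
    nab Y p (X p) - nab X p (Y p) = VectorField.mlieBracket (𝓡 4) X Y p
  metric : ∀ (Y Z : VField M) (p : M), Y.DiffAt p → Z.DiffAt p → ∀ v : T p,
    dirDeriv (fun q ↦ g q (Y q) (Z q)) p v = g p (nab Y p v) (Z p) + g p (Y p) (nab Z p v)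

end Basic

/-- A locally rotationally symmetric (LRS) spacetime in the 1+1+2 semi-tetrad description, with
unit timelike field `u`, unit spacelike preferred direction `e` orthogonal to it, and volume
element `eps` of the sheet `{u, e}ᗮ`: in the double decomposition of `∇u` and `∇e` every vector and
tensor part vanishes, and the remaining kinematical scalars have no gradient along the sheet. -/
structure LRSSpacetime (M : Type*) [TopologicalSpace M]
    [ChartedSpace (EuclideanSpace ℝ (Fin 4)) M] [IsManifold (𝓡 4) ∞ M] where
  g : TwoTensor M
  nab : CovariantDerivative (𝓡 4) (EuclideanSpace ℝ (Fin 4)) (TangentSpace (𝓡 4) : M → Type _)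
  u : VField M
  e : VField M
  eps : TwoTensor M
  lorentz : IsLorentzMetric g
  leviCivita : IsLeviCivita g nab
  smooth_u : u.Smooth
  smooth_e : e.Smooth
  u_u : ∀ p, g p (u p) (u p) = -1
  e_e : ∀ p, g p (e p) (e p) = 1
  u_e : ∀ p, g p (u p) (e p) = 0
  smooth_eps : eps.Smooth
  eps_antisymm : ∀ (p : M) (v w : T p), eps p v w = -eps p w v
  eps_u : ∀ (p : M) (v : T p), eps p (u p) v = 0
  eps_e : ∀ (p : M) (v : T p), eps p (e p) v = 0
  /-- `eps` is the area form of the metric induced on the sheet. -/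
  eps_area : ∀ (p : M) (v w : T p), g p (u p) v = 0 → g p (e p) v = 0 →
    g p (u p) w = 0 → g p (e p) w = 0 →
    eps p v w ^ 2 = g p v v * g p w w - g p v w ^ 2
  /-- acceleration -/
  Acc : M → ℝ
  /-- expansion of `u` -/
  Θ : M → ℝ
  /-- shear of `u` -/
  Shear : M → ℝ
  /-- rotation (vorticity) of `u` -/
  Ω : M → ℝ
  /-- expansion of the sheet -/
  φ : M → ℝ
  /-- twist of `e` -/
  ξ : M → ℝ
  scalars : ∀ f ∈ ({Acc, Θ, Shear, Ω, φ, ξ} : Set (M → ℝ)),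
    ContMDiff (𝓡 4) 𝓘(ℝ, ℝ) ∞ f ∧
      ∀ (p : M) (v : T p), g p (u p) v = 0 → g p (e p) v = 0 → dirDeriv f p v = 0
  /-- `∇_a u_b = -𝒜 u_a e_b + (Θ/3 + Σ) e_a e_b + Ω ε_ab + (Θ/3 - Σ/2) N_ab`,
  where `N_ab = g_ab + u_a u_b - e_a e_b`. -/
  nab_u : ∀ (p : M) (v w : T p), g p (nab u p v) w =
    -Acc p * (g p (u p) v * g p (e p) w)
      + (Θ p / 3 + Shear p) * (g p (e p) v * g p (e p) w)
      + Ω p * eps p v w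
      + (Θ p / 3 - Shear p / 2) *
        (g p v w + g p (u p) v * g p (u p) w - g p (e p) v * g p (e p) w)
  /-- `∇_a e_b = -𝒜 u_a u_b + (Θ/3 + Σ) e_a u_b + (φ/2) N_ab + ξ ε_ab`; projected orthogonally
  to `u` in both indices this is `D_a e_b = (φ/2) N_ab + ξ ε_ab`. -/
  nab_e : ∀ (p : M) (v w : T p), g p (nab e p v) w =
    -Acc p * (g p (u p) v * g p (u p) w)
      + (Θ p / 3 + Shear p) * (g p (e p) v * g p (u p) w)
      + φ p / 2 *
        (g p v w + g p (u p) v * g p (u p) w - g p (e p) v * g p (e p) w)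
      + ξ p * eps p v w

namespace LRSSpacetime

variable {M : Type*} [TopologicalSpace M] [ChartedSpace (EuclideanSpace ℝ (Fin 4)) M]
  [IsManifold (𝓡 4) ∞ M] (S : LRSSpacetime M)

/-- An LRS scalar: a smooth function all of whose derivatives along the sheet vanish, i.e.
`∇_a Ψ = -Ψ̇ u_a + Ψ̂ e_a`. -/
def IsScalar (Ψ : M → ℝ) : Prop :=
  ContMDiff (𝓡 4) 𝓘(ℝ, ℝ) ∞ Ψ ∧
    ∀ (p : M) (v : T p), S.g p (S.u p) v = 0 → S.g p (S.e p) v = 0 → dirDeriv Ψ p v = 0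

/-- The dot derivative `Ψ̇ = u^a ∇_a Ψ` of a scalar. -/
def dot (Ψ : M → ℝ) (p : M) : ℝ := dirDeriv Ψ p (S.u p)

/-- The hat derivative `Ψ̂ = e^a ∇_a Ψ` of a scalar. -/
def hat (Ψ : M → ℝ) (p : M) : ℝ := dirDeriv Ψ p (S.e p)

/-- The spacetime is simultaneously rotating and twisting. -/
def RotatingTwisting : Prop := ∀ p, S.Ω p * S.ξ p ≠ 0

/-- `τ` and `ρ` are curve parameters for the LRS scalars: they are smooth and independent, and
every LRS scalar is locally a function `ψ` of `(τ, ρ)` with `Ψ̇ = ∂ψ/∂τ` and `Ψ̂ = ∂ψ/∂ρ`. -/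
structure AreCurveParameters (τ ρ : M → ℝ) : Prop where
  smooth_τ : ContMDiff (𝓡 4) 𝓘(ℝ, ℝ) ∞ τ
  smooth_ρ : ContMDiff (𝓡 4) 𝓘(ℝ, ℝ) ∞ ρ
  independent : ∀ p : M, ∀ x y : ℝ, ∃ v : T p, dirDeriv τ p v = x ∧ dirDeriv ρ p v = y
  scalar : ∀ Ψ : M → ℝ, S.IsScalar Ψ → ∀ p : M, ∃ ψ : ℝ × ℝ → ℝ, ∀ᶠ q in 𝓝 p,
    Ψ q = ψ (τ q, ρ q) ∧
      HasFDerivAt ψ (S.dot Ψ q • ContinuousLinearMap.fst ℝ ℝ ℝ +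
        S.hat Ψ q • ContinuousLinearMap.snd ℝ ℝ ℝ) (τ q, ρ q)

/-- The LRS scalar `Ψ` has scaling weight `n`: `Ψ(τ, ρ) = a ^ n * Ψ(a τ, a ρ)` for `a > 0`.
A dimensionless scalar is one of weight `0`. -/
def HasWeight (τ ρ : M → ℝ) (n : ℝ) (Ψ : M → ℝ) : Prop :=
  S.IsScalar Ψ ∧ ∀ a : ℝ, 0 < a → ∀ p q : M, τ q = a * τ p → ρ q = a * ρ p → Ψ p = a ^ n * Ψ q

end LRSSpacetime

end LRS

end

namespace LRS

/-! ### Calculus of directional derivatives on the manifold, computed in charts. -/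

section Calculus

/-! The commutator of two sheet fields kills every LRS scalar. Its `u` and `e` components are fixed
by the antisymmetric parts of `∇u` and `∇e`, that is by `Ω` and `ξ`, which gives `Ψ̇ Ω = Ψ̂ ξ`
(`IsScalar.dot_mul_Ω`). Commuting a sheet field with `u` or `e` shows that `Ψ̇` and `Ψ̂` are again
LRS scalars.

With curve parameters, `dΨ = Ψ̇ dτ + Ψ̂ dρ`, so dot and hat commute (`hat_dot`). Put `R = Ω/ξ`, so
that hat is `R` times dot. Applied to `R` itself, commutation forces `Ṙ² = 0`, hence `R` is a
constant `r` (`exists_ratio`). Every scalar then has differential `Ψ̇ dw` with `w = τ + rρ`, and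
weight `n` becomes the Euler equation `w Ψ̇ = -nΨ`, whose solutions are multiples of `w⁻ⁿ`.

The delicate point is that `w` may vanish and its zero set may disconnect `M`, so integration must
not divide by `w`. For integer `n` one uses that `Ψ wⁿ` is constant (`n > 0`) or descends by
differentiating (`n ≤ 0`). A nowhere vanishing scalar of weight one forces `w ≠ 0` everywhere, and
real weights become accessible. Finally `(Az + B)ρ = Aw` when `B = rA`. -/

lemma two_le_infty : (2 : WithTop ℕ∞) ≤ ∞ := by
  exact WithTop.coe_le_coe.2 (le_top : (2 : ℕ∞) ≤ ⊤)

variable {M : Type*} [TopologicalSpace M] [ChartedSpace (EuclideanSpace ℝ (Fin 4)) M]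

/-- The differential of a function is the derivative of its coordinate representation. -/
lemma dirDeriv_eq_fderiv {f : M → ℝ} {p : M} (hf : MDifferentiableAt (𝓡 4) 𝓘(ℝ, ℝ) f p)
    (v : T p) :
    dirDeriv f p v = fderiv ℝ (f ∘ (extChartAt (𝓡 4) p).symm) (extChartAt (𝓡 4) p p) v := by
  simp only [dirDeriv, mfderiv, hf, writtenInExtChartAt, ModelWithCorners.range_eq_univ,
    fderivWithin_univ]
  rfl

lemma MDifferentiableAt.differentiableAt_chart {f : M → ℝ} {p : M}
    (hf : MDifferentiableAt (𝓡 4) 𝓘(ℝ, ℝ) f p) :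
    DifferentiableAt ℝ (f ∘ (extChartAt (𝓡 4) p).symm) (extChartAt (𝓡 4) p p) := by
  have := (mdifferentiableAt_iff _ _).1 hf |>.2
  rw [ModelWithCorners.range_eq_univ, differentiableWithinAt_univ] at this
  exact this

lemma dirDeriv_congr {f h : M → ℝ} {p : M} (hfh : f =ᶠ[𝓝 p] h) (v : T p) :
    dirDeriv f p v = dirDeriv h p v := by
  simp only [dirDeriv, hfh.mfderiv_eq]
  rfl

lemma dirDeriv_const (c : ℝ) (p : M) (v : T p) : dirDeriv (fun _ : M ↦ c) p v = 0 := by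
  simp only [dirDeriv, mfderiv_const]
  rfl

lemma dirDeriv_add {f h : M → ℝ} {p : M} (hf : MDifferentiableAt (𝓡 4) 𝓘(ℝ, ℝ) f p)
    (hh : MDifferentiableAt (𝓡 4) 𝓘(ℝ, ℝ) h p) (v : T p) :
    dirDeriv (fun q ↦ f q + h q) p v = dirDeriv f p v + dirDeriv h p v := by
  have H : MDifferentiableAt (𝓡 4) 𝓘(ℝ, ℝ) (fun q ↦ f q + h q) p := hf.add hh
  rw [dirDeriv_eq_fderiv H, dirDeriv_eq_fderiv hf, dirDeriv_eq_fderiv hh]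
  have := fderiv_add (MDifferentiableAt.differentiableAt_chart hf)
    (MDifferentiableAt.differentiableAt_chart hh)
  exact congrArg (fun L ↦ L v) this

lemma dirDeriv_mul {f h : M → ℝ} {p : M} (hf : MDifferentiableAt (𝓡 4) 𝓘(ℝ, ℝ) f p)
    (hh : MDifferentiableAt (𝓡 4) 𝓘(ℝ, ℝ) h p) (v : T p) :
    dirDeriv (fun q ↦ f q * h q) p v = f p * dirDeriv h p v + dirDeriv f p v * h p := by
  have H : MDifferentiableAt (𝓡 4) 𝓘(ℝ, ℝ) (fun q ↦ f q * h q) p := hf.mul hh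
  rw [dirDeriv_eq_fderiv H, dirDeriv_eq_fderiv hf, dirDeriv_eq_fderiv hh]
  have := fderiv_mul (MDifferentiableAt.differentiableAt_chart hf)
    (MDifferentiableAt.differentiableAt_chart hh)
  have key (a b : ℝ) (K L : EuclideanSpace ℝ (Fin 4) →L[ℝ] ℝ) (w : EuclideanSpace ℝ (Fin 4)) :
      (a • K + b • L) w = a * K w + L w * b := by
    simp [mul_comm]
  simp only [Function.comp_apply, extChartAt_to_inv] at this
  exact (congrArg (fun L ↦ L v) this).trans (key _ _ _ _ _)

lemma dirDeriv_comp {F : ℝ → ℝ} {F' : ℝ} {f : M → ℝ} {p : M}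
    (hF : HasDerivAt F F' (f p)) (hf : MDifferentiableAt (𝓡 4) 𝓘(ℝ, ℝ) f p) (v : T p) :
    dirDeriv (fun q ↦ F (f q)) p v = F' * dirDeriv f p v := by
  have H : MDifferentiableAt (𝓡 4) 𝓘(ℝ, ℝ) (fun q ↦ F (f q)) p :=
    MDifferentiableAt.comp p hF.differentiableAt.mdifferentiableAt hf
  rw [dirDeriv_eq_fderiv H, dirDeriv_eq_fderiv hf]
  have h1 := (MDifferentiableAt.differentiableAt_chart hf).hasFDerivAt
  have h2 : HasDerivAt F F' ((f ∘ (extChartAt (𝓡 4) p).symm) (extChartAt (𝓡 4) p p)) := by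
    simpa using hF
  have := (h2.comp_hasFDerivAt _ h1).fderiv
  exact congrArg (fun L ↦ L v) this

/-- A function that is locally a function of two others. -/
lemma dirDeriv_comp_prod {ψ : ℝ × ℝ → ℝ} {L : ℝ × ℝ →L[ℝ] ℝ} {f h Ψ : M → ℝ} {p : M}
    (hψ : HasFDerivAt ψ L (f p, h p)) (hf : MDifferentiableAt (𝓡 4) 𝓘(ℝ, ℝ) f p)
    (hh : MDifferentiableAt (𝓡 4) 𝓘(ℝ, ℝ) h p) (hΨ : MDifferentiableAt (𝓡 4) 𝓘(ℝ, ℝ) Ψ p)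
    (hE : ∀ᶠ q in 𝓝 p, Ψ q = ψ (f q, h q)) (v : T p) :
    dirDeriv Ψ p v = L (dirDeriv f p v, dirDeriv h p v) := by
  rw [dirDeriv_eq_fderiv hΨ, dirDeriv_eq_fderiv hf, dirDeriv_eq_fderiv hh]
  have h1 := (MDifferentiableAt.differentiableAt_chart hf).hasFDerivAt
  have h2 := (MDifferentiableAt.differentiableAt_chart hh).hasFDerivAt
  have h3 : HasFDerivAt ψ L ((fun x ↦ ((f ∘ (extChartAt (𝓡 4) p).symm) x,
      (h ∘ (extChartAt (𝓡 4) p).symm) x)) (extChartAt (𝓡 4) p p)) := by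
    simpa using hψ
  have h4 := HasFDerivAt.comp (extChartAt (𝓡 4) p p) h3 (h1.prodMk h2)
  have h5 : Ψ ∘ (extChartAt (𝓡 4) p).symm =ᶠ[𝓝 (extChartAt (𝓡 4) p p)]
      ψ ∘ fun x ↦ ((f ∘ (extChartAt (𝓡 4) p).symm) x, (h ∘ (extChartAt (𝓡 4) p).symm) x) := by
    have hc : Filter.Tendsto (extChartAt (𝓡 4) p).symm (𝓝 (extChartAt (𝓡 4) p p)) (𝓝 p) := by
      simpa [ContinuousAt] using continuousAt_extChartAt_symm (I := 𝓡 4) p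
    filter_upwards [hc.eventually hE] with x hx using hx
  rw [h5.fderiv_eq, h4.fderiv]
  rfl

variable [IsManifold (𝓡 4) ∞ M]

omit [IsManifold (𝓡 4) ∞ M] in
lemma ContMDiff.mdiffAt {f : M → ℝ} (hf : ContMDiff (𝓡 4) 𝓘(ℝ, ℝ) ∞ f) (p : M) :
    MDifferentiableAt (𝓡 4) 𝓘(ℝ, ℝ) f p :=
  hf.mdifferentiable (by simp) p

omit [IsManifold (𝓡 4) ∞ M] in
lemma ContMDiff.contDiffAt_chart {f : M → ℝ} (hf : ContMDiff (𝓡 4) 𝓘(ℝ, ℝ) ∞ f) (p : M) :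
    ContDiffAt ℝ ∞ (f ∘ (extChartAt (𝓡 4) p).symm) (extChartAt (𝓡 4) p p) := by
  have := (contMDiffAt_iff.1 (hf p)).2
  rw [ModelWithCorners.range_eq_univ, contDiffWithinAt_univ] at this
  exact this

lemma hasFDerivAt_chart {f : M → ℝ} {p : M} {x : EuclideanSpace ℝ (Fin 4)}
    (hx : x ∈ (extChartAt (𝓡 4) p).target)
    (hf : MDifferentiableAt (𝓡 4) 𝓘(ℝ, ℝ) f ((extChartAt (𝓡 4) p).symm x)) :
    HasFDerivAt (f ∘ (extChartAt (𝓡 4) p).symm)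
      ((mfderiv (𝓡 4) 𝓘(ℝ, ℝ) f ((extChartAt (𝓡 4) p).symm x)).comp
        (mfderivWithin 𝓘(ℝ, EuclideanSpace ℝ (Fin 4)) (𝓡 4) (extChartAt (𝓡 4) p).symm
          (Set.range (𝓡 4)) x)) x := by
  have hs : MDifferentiableAt 𝓘(ℝ, EuclideanSpace ℝ (Fin 4)) (𝓡 4)
      (extChartAt (𝓡 4) p).symm x := by
    have := mdifferentiableWithinAt_extChartAt_symm (I := 𝓡 4) hx
    rwa [ModelWithCorners.range_eq_univ, mdifferentiableWithinAt_univ] at this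
  rw [ModelWithCorners.range_eq_univ, mfderivWithin_univ]
  exact (hf.hasMFDerivAt.comp x hs.hasMFDerivAt).hasFDerivAt

/-- A function on a connected manifold whose differential vanishes is constant. -/
lemma exists_eq_const_of_dirDeriv_eq_zero [ConnectedSpace M]
    {f : M → ℝ}
    (hf : ∀ p, MDifferentiableAt (𝓡 4) 𝓘(ℝ, ℝ) f p) (h0 : ∀ p (v : T p), dirDeriv f p v = 0) :
    ∃ c, ∀ p, f p = c := by
  have hl : IsLocallyConstant f := by
    rw [IsLocallyConstant.iff_eventually_eq]
    intro p
    set φ := extChartAt (𝓡 4) p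
    obtain ⟨ε, hε, hb⟩ := Metric.isOpen_iff.1 (isOpen_extChartAt_target (I := 𝓡 4) p) (φ p)
      (mem_extChartAt_target p)
    have hd : ∀ x ∈ Metric.ball (φ p) ε, HasFDerivAt (f ∘ φ.symm)
        (0 : EuclideanSpace ℝ (Fin 4) →L[ℝ] ℝ) x := by
      intro x hx
      have h := hasFDerivAt_chart (hb hx) (hf _)
      refine h.congr_fderiv ?_
      ext1 v
      exact h0 _ _
    have hconst : ∀ x ∈ Metric.ball (φ p) ε, (f ∘ φ.symm) x = f p := by
      intro x hx
      have := (convex_ball (φ p) ε).is_const_of_fderivWithin_eq_zero (𝕜 := ℝ) (f := f ∘ φ.symm)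
        (fun y hy ↦ (hd y hy).differentiableAt.differentiableWithinAt)
        (fun y hy ↦ by
          rw [fderivWithin_of_isOpen Metric.isOpen_ball hy, (hd y hy).fderiv])
        hx (Metric.mem_ball_self hε)
      simpa [φ] using this
    have hc : Filter.Tendsto φ (𝓝 p) (𝓝 (φ p)) := continuousAt_extChartAt p
    filter_upwards [hc.eventually (Metric.ball_mem_nhds _ hε),
        extChartAt_source_mem_nhds (I := 𝓡 4) p]
      with q hq hqs
    rw [← hconst _ hq]
    simp [φ.left_inv hqs]
  obtain ⟨p⟩ : Nonempty M := inferInstance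
  exact ⟨f p, fun q ↦ hl.apply_eq_of_isPreconnected isPreconnected_univ trivial trivial⟩

lemma contMDiff_dirDeriv {f : M → ℝ} (hf : ContMDiff (𝓡 4) 𝓘(ℝ, ℝ) ∞ f) {X : VField M}
    (hX : X.Smooth) : ContMDiff (𝓡 4) 𝓘(ℝ, ℝ) ∞ fun q ↦ dirDeriv f q (X q) := by
  have h1 : ContMDiff (𝓡 4).tangent 𝓘(ℝ, ℝ).tangent ∞ (tangentMap (𝓡 4) 𝓘(ℝ, ℝ) f) :=
    hf.contMDiff_tangentMap (by simp)
  exact (contMDiff_snd_tangentBundle_modelSpace ℝ 𝓘(ℝ, ℝ)).comp (h1.comp hX)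

lemma mdifferentiableAt_dirDeriv {f : M → ℝ} (hf : ContMDiff (𝓡 4) 𝓘(ℝ, ℝ) ∞ f) {X : VField M}
    {p : M} (hX : X.DiffAt p) :
    MDifferentiableAt (𝓡 4) 𝓘(ℝ, ℝ) (fun q ↦ dirDeriv f q (X q)) p := by
  have h1 : ContMDiff (𝓡 4).tangent 𝓘(ℝ, ℝ).tangent 1 (tangentMap (𝓡 4) 𝓘(ℝ, ℝ) f) :=
    hf.contMDiff_tangentMap (one_add_one_eq_two.trans_le two_le_infty)
  exact ((contMDiff_snd_tangentBundle_modelSpace (n := 1) ℝ 𝓘(ℝ, ℝ)).mdifferentiable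
    one_ne_zero _).comp p ((h1.mdifferentiable one_ne_zero _).comp p hX)

/-- The Lie bracket of vector fields is the commutator of the derivatives along them. -/
lemma dirDeriv_mlieBracket {f : M → ℝ} (hf : ContMDiff (𝓡 4) 𝓘(ℝ, ℝ) ∞ f) {X Y : VField M}
    {p : M} (hX : X.DiffAt p) (hY : Y.DiffAt p) :
    dirDeriv f p (VectorField.mlieBracket (𝓡 4) X Y p) =
      dirDeriv (fun q ↦ dirDeriv f q (Y q)) p (X p) -
        dirDeriv (fun q ↦ dirDeriv f q (X q)) p (Y p) := by
  let φ := extChartAt (𝓡 4) p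
  let F : EuclideanSpace ℝ (Fin 4) → ℝ := f ∘ φ.symm
  let P : VField M → EuclideanSpace ℝ (Fin 4) → EuclideanSpace ℝ (Fin 4) := fun Z ↦
    VectorField.mpullbackWithin 𝓘(ℝ, EuclideanSpace ℝ (Fin 4)) (𝓡 4) φ.symm Z (Set.range (𝓡 4))
  have hset : φ.symm ⁻¹' Set.univ ∩ Set.range (𝓡 4) = Set.univ := by simp
  have hP0 (Z : VField M) : P Z (φ p) = Z p := by
    simp only [P, VectorField.mpullbackWithin_apply]
    rw [extChartAt_to_inv]
    exact mfderivWithin_extChartAt_symm_inverse_apply (Z p)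
  have hPd {Z : VField M} (hZ : Z.DiffAt p) : DifferentiableAt ℝ (P Z) (φ p) := by
    have h1 : DifferentiableWithinAt ℝ (P Z) (φ.symm ⁻¹' Set.univ ∩ Set.range (𝓡 4)) (φ p) :=
      MDifferentiableWithinAt.differentiableWithinAt_mpullbackWithin_vectorField
        (mdifferentiableWithinAt_univ.2 hZ)
    rwa [hset, differentiableWithinAt_univ] at h1
  have hFP (Z : VField M) : ∀ᶠ x in 𝓝 (φ p),
      ((fun q ↦ dirDeriv f q (Z q)) ∘ φ.symm) x = fderiv ℝ F x (P Z x) := by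
    filter_upwards [extChartAt_target_mem_nhds (I := 𝓡 4) p] with x hx
    have hfd := HasFDerivAt.fderiv (𝕜 := ℝ) (E := EuclideanSpace ℝ (Fin 4)) (F := ℝ) (f := F)
      (hasFDerivAt_chart hx (ContMDiff.mdiffAt hf _))
    rw [hfd]
    have hi := isInvertible_mfderivWithin_extChartAt_symm (I := 𝓡 4) hx
    exact congrArg (mfderiv (𝓡 4) 𝓘(ℝ, ℝ) f (φ.symm x))
      (hi.self_apply_inverse (Z (φ.symm x))).symm
  have hF : ContDiffAt ℝ ∞ F (φ p) := ContMDiff.contDiffAt_chart hf p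
  have hF' : DifferentiableAt ℝ (fderiv ℝ F) (φ p) :=
    (hF.fderiv_right (m := 1) (one_add_one_eq_two.trans_le two_le_infty)).differentiableAt one_ne_zero
  have hsymm := hF.isSymmSndFDerivAt (by simpa using two_le_infty)
  have key {Z : VField M} (hZ : Z.DiffAt p) (v : T p) :
      dirDeriv (fun q ↦ dirDeriv f q (Z q)) p v =
        fderiv ℝ F (φ p) (fderiv ℝ (P Z) (φ p) v) + fderiv ℝ (fderiv ℝ F) (φ p) v (Z p) := by
    rw [dirDeriv_eq_fderiv (mdifferentiableAt_dirDeriv hf hZ), Filter.EventuallyEq.fderiv_eq (hFP Z),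
      fderiv_clm_apply hF' (hPd hZ), ← hP0 Z]
    rfl
  rw [key hY, key hX, dirDeriv_eq_fderiv (ContMDiff.mdiffAt hf p)]
  have hb : VectorField.mlieBracket (𝓡 4) X Y p =
      fderiv ℝ (P Y) (φ p) (X p) - fderiv ℝ (P X) (φ p) (Y p) := by
    have hinv (y : EuclideanSpace ℝ (Fin 4)) :
        (mfderiv (𝓡 4) 𝓘(ℝ, EuclideanSpace ℝ (Fin 4)) φ p).inverse y = y :=
      (congrArg (fun L : EuclideanSpace ℝ (Fin 4) →L[ℝ] EuclideanSpace ℝ (Fin 4) ↦ L.inverse y)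
        (mfderiv_extChartAt_self (I := 𝓡 4))).trans
        (congrArg (fun L : EuclideanSpace ℝ (Fin 4) →L[ℝ] EuclideanSpace ℝ (Fin 4) ↦ L y)
          ContinuousLinearMap.inverse_id)
    have hlie : VectorField.lieBracketWithin ℝ (P X) (P Y)
        (φ.symm ⁻¹' Set.univ ∩ Set.range (𝓡 4)) (φ p) =
        fderiv ℝ (P Y) (φ p) (P X (φ p)) - fderiv ℝ (P X) (φ p) (P Y (φ p)) := by
      rw [hset, VectorField.lieBracketWithin_univ]
      rfl
    rw [hP0, hP0] at hlie
    rw [← VectorField.mlieBracketWithin_univ]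
    exact (hinv _).trans hlie
  rw [hb]
  -- The Hessian terms of the two iterated derivatives cancel by symmetry, leaving only the bracket
  -- term.
  have := hsymm (X p) (Y p)
  have h2 := (fderiv ℝ F (φ p)).map_sub (fderiv ℝ (P Y) (φ p) (X p)) (fderiv ℝ (P X) (φ p) (Y p))
  change fderiv ℝ F (φ p) _ = _
  linear_combination h2 - this

end Calculus

/-! ### Differentiability of fields and linear algebra of the Lorentz metric. -/

section Fields

variable {M : Type*} [TopologicalSpace M] [ChartedSpace (EuclideanSpace ℝ (Fin 4)) M]
  [IsManifold (𝓡 4) ∞ M]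

lemma VField.Smooth.diffAt {X : VField M} (hX : X.Smooth) (p : M) : X.DiffAt p :=
  ContMDiff.mdifferentiable hX (by simp) p

lemma TwoTensor.Smooth.mdifferentiableAt_apply {t : TwoTensor M} (ht : t.Smooth) {X Y : VField M}
    {p : M} (hX : X.DiffAt p) (hY : Y.DiffAt p) :
    MDifferentiableAt (𝓡 4) 𝓘(ℝ, ℝ) (fun q ↦ t q (X q) (Y q)) p := by
  have := MDifferentiableAt.clm_bundle_apply₂ (F₁ := EuclideanSpace ℝ (Fin 4))
    (F₂ := EuclideanSpace ℝ (Fin 4)) (F₃ := ℝ) (E₁ := (TangentSpace (𝓡 4) : M → Type _))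
    (E₂ := (TangentSpace (𝓡 4) : M → Type _)) (E₃ := Bundle.Trivial M ℝ) (b := id)
    (ContMDiff.mdifferentiable ht (by simp) p) hX hY
  simpa using
    ((mdifferentiableAt_totalSpace (F := ℝ) (E := Bundle.Trivial M ℝ) _ _).1 this).2

end Fields

namespace IsLorentzMetric

variable {M : Type*} [TopologicalSpace M] [ChartedSpace (EuclideanSpace ℝ (Fin 4)) M]
  [IsManifold (𝓡 4) ∞ M] {g : TwoTensor M}

lemma eq_zero_of_forall_eq_zero (hg : IsLorentzMetric g) {p : M} {v : T p}
    (h : ∀ w, g p v w = 0) : v = 0 := by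
  obtain ⟨b, hb⟩ := hg.signature p
  refine b.repr.map_eq_zero_iff.1 (Finsupp.ext fun j ↦ ?_)
  have h1 := h (b j)
  rw [← b.sum_repr v, map_sum, sum_apply] at h1
  simp only [map_smul, smul_apply, hb, smul_eq_mul, mul_ite, mul_zero,
    Finset.sum_ite_eq', Finset.mem_univ, if_true] at h1
  by_cases hj : j = 0 <;> simpa [hj] using h1

lemma exists_ne_zero_orthogonal (hg : IsLorentzMetric g) {p : M} (x y z : T p) :
    ∃ v : T p, v ≠ 0 ∧ g p x v = 0 ∧ g p y v = 0 ∧ g p z v = 0 := by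
  obtain ⟨b, -⟩ := hg.signature p
  let L : T p →ₗ[ℝ] (Fin 3 → ℝ) :=
    LinearMap.pi ![(g p x : T p →ₗ[ℝ] ℝ), (g p y : T p →ₗ[ℝ] ℝ), (g p z : T p →ₗ[ℝ] ℝ)]
  have : FiniteDimensional ℝ (T p) := Module.Basis.finiteDimensional_of_finite b
  have hL : LinearMap.ker L ≠ ⊥ := LinearMap.ker_ne_bot_of_finrank_lt (by
    rw [Module.finrank_eq_card_basis b]; simp)
  obtain ⟨v, hv, hv0⟩ := (Submodule.ne_bot_iff _).1 hL
  have h := fun i ↦ congrFun (LinearMap.mem_ker.1 hv) i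
  exact ⟨v, hv0, h 0, h 1, h 2⟩

end IsLorentzMetric

/-! ### Commutators and the relation between the dot and hat derivatives. -/

namespace LRSSpacetime

variable {M : Type*} [TopologicalSpace M] [ChartedSpace (EuclideanSpace ℝ (Fin 4)) M]
  [IsManifold (𝓡 4) ∞ M] (S : LRSSpacetime M)

lemma e_u (p : M) : S.g p (S.e p) (S.u p) = 0 := by rw [S.lorentz.symm, S.u_e]

/-- The vector `v` is tangent to the sheet. -/
def IsSheet (p : M) (v : T p) : Prop := S.g p (S.u p) v = 0 ∧ S.g p (S.e p) v = 0

/-- The orthogonal projection to the sheet. -/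
noncomputable def sheetProj (p : M) (v : T p) : T p :=
  v + S.g p (S.u p) v • S.u p - S.g p (S.e p) v • S.e p

lemma isSheet_sheetProj (p : M) (v : T p) : S.IsSheet p (S.sheetProj p v) := by
  constructor <;> simp [sheetProj, S.u_u, S.e_e, S.u_e, S.e_u]

lemma sheetProj_eq_self {p : M} {v : T p} (hv : S.IsSheet p v) : S.sheetProj p v = v := by
  simp [sheetProj, hv.1, hv.2]

/-- A sheet vector extends to a field of sheet vectors. -/
lemma exists_sheet_field {p : M} {v : T p} (hv : S.IsSheet p v) :
    ∃ X : VField M, X.DiffAt p ∧ X p = v ∧ ∀ q, S.IsSheet q (X q) := by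
  let V : VField M := FiberBundle.extend (EuclideanSpace ℝ (Fin 4)) v
  have hV : V.DiffAt p := FiberBundle.mdifferentiableAt_extend (𝓡 4) (EuclideanSpace ℝ (Fin 4)) v
  refine ⟨fun q ↦ S.sheetProj q (V q), ?_, ?_, fun q ↦ S.isSheet_sheetProj q _⟩
  · have hu := S.smooth_u.diffAt p
    have he := S.smooth_e.diffAt p
    exact mdifferentiableAt_sub_section (mdifferentiableAt_add_section hV
      (MDifferentiableAt.smul_section (S.lorentz.smooth.mdifferentiableAt_apply hu hV) hu))
      (MDifferentiableAt.smul_section (S.lorentz.smooth.mdifferentiableAt_apply he hV) he)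
  · have : V p = v := by simp [V]
    simp only [this]
    exact S.sheetProj_eq_self hv

/-- If the area form vanished on the sheet, all Gram determinants there would vanish. A null sheet
vector would then be orthogonal to everything, hence zero. But two nonzero orthogonal sheet vectors
exist by counting dimensions, and one of them would have to be null. -/
lemma exists_eps_ne_zero (p : M) :
    ∃ v w : T p, S.IsSheet p v ∧ S.IsSheet p w ∧ S.eps p v w ≠ 0 := by
  by_contra! H
  have gram (v w : T p) (hv : S.IsSheet p v) (hw : S.IsSheet p w) :
      S.g p v v * S.g p w w = S.g p v w ^ 2 := by
    have := S.eps_area p v w hv.1 hv.2 hw.1 hw.2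
    rw [H v w hv hw] at this
    linear_combination -this
  have nondeg (v : T p) (hv : S.IsSheet p v) (h0 : S.g p v v = 0) : v = 0 := by
    refine S.lorentz.eq_zero_of_forall_eq_zero fun x ↦ ?_
    have h1 := gram v _ hv (S.isSheet_sheetProj p x)
    rw [h0, zero_mul, eq_comm, sq_eq_zero_iff] at h1
    simpa [sheetProj, S.lorentz.symm p v, hv.1, hv.2] using h1
  obtain ⟨v, hv0, hv1, hv2, -⟩ := S.lorentz.exists_ne_zero_orthogonal (S.u p) (S.e p) (S.e p)
  obtain ⟨w, hw0, hw1, hw2, hw3⟩ := S.lorentz.exists_ne_zero_orthogonal (S.u p) (S.e p) v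
  have h := gram v w ⟨hv1, hv2⟩ ⟨hw1, hw2⟩
  rw [hw3, zero_pow two_ne_zero, mul_eq_zero] at h
  exact h.elim (fun h ↦ hv0 (nondeg v ⟨hv1, hv2⟩ h)) fun h ↦ hw0 (nondeg w ⟨hw1, hw2⟩ h)

variable {S}

lemma IsScalar.dirDeriv_eq {Ψ : M → ℝ} (hΨ : S.IsScalar Ψ) (p : M) (x : T p) :
    dirDeriv Ψ p x = -S.g p (S.u p) x * S.dot Ψ p + S.g p (S.e p) x * S.hat Ψ p := by
  have h1 := hΨ.2 p _ (S.isSheet_sheetProj p x).1 (S.isSheet_sheetProj p x).2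
  have h2 : dirDeriv Ψ p (S.sheetProj p x) =
      dirDeriv Ψ p x + S.g p (S.u p) x * S.dot Ψ p - S.g p (S.e p) x * S.hat Ψ p := by
    let D : T p →L[ℝ] ℝ := mfderiv (𝓡 4) 𝓘(ℝ, ℝ) Ψ p
    change D (_ + _ - _) = D _ + _ * D _ - _ * D _
    simp
  linear_combination h1 - h2

lemma IsScalar.mdiffAt {Ψ : M → ℝ} (hΨ : S.IsScalar Ψ) (p : M) :
    MDifferentiableAt (𝓡 4) 𝓘(ℝ, ℝ) Ψ p := ContMDiff.mdiffAt hΨ.1 p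

variable (S)

lemma isScalar_Ω : S.IsScalar S.Ω := S.scalars _ (by simp)

lemma isScalar_ξ : S.IsScalar S.ξ := S.scalars _ (by simp)

lemma eps_self_u (p : M) (v : T p) : S.eps p v (S.u p) = 0 := by
  rw [S.eps_antisymm, S.eps_u, neg_zero]

lemma eps_self_e (p : M) (v : T p) : S.eps p v (S.e p) = 0 := by
  rw [S.eps_antisymm, S.eps_e, neg_zero]

/-- Two fields that are everywhere orthogonal. -/
lemma metric_orthogonal {Y Z : VField M} {p : M} (hY : Y.DiffAt p) (hZ : Z.DiffAt p)
    (h : ∀ q, S.g q (Y q) (Z q) = 0) (v : T p) :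
    S.g p (Y p) (S.nab Z p v) = -S.g p (S.nab Y p v) (Z p) := by
  have := S.leviCivita.metric Y Z p hY hZ v
  rw [funext h, dirDeriv_const] at this
  linear_combination -this

/-- The derivative of a scalar along the commutator of two fields. -/
lemma dirDeriv_commutator {Ψ : M → ℝ} (hΨ : S.IsScalar Ψ) {X Y : VField M} {p : M}
    (hX : X.DiffAt p) (hY : Y.DiffAt p) :
    dirDeriv (fun q ↦ dirDeriv Ψ q (Y q)) p (X p) - dirDeriv (fun q ↦ dirDeriv Ψ q (X q)) p (Y p) =
      -(S.g p (S.u p) (S.nab Y p (X p)) - S.g p (S.u p) (S.nab X p (Y p))) * S.dot Ψ p +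
        (S.g p (S.e p) (S.nab Y p (X p)) - S.g p (S.e p) (S.nab X p (Y p))) * S.hat Ψ p := by
  rw [← dirDeriv_mlieBracket hΨ.1 hX hY, ← S.leviCivita.torsionFree X Y p hX hY,
    hΨ.dirDeriv_eq, map_sub, map_sub]

variable {S}

/-- Sheet fields `X`, `Y` annihilate `Ψ`, hence so does `[X, Y]`. The symmetric `N` terms drop out
of its `u` and `e` components, which are `-2Ω ε(X, Y)` and `-2ξ ε(X, Y)` after pairing with `u` and
`e`. -/
lemma IsScalar.dot_mul_Ω {Ψ : M → ℝ} (hΨ : S.IsScalar Ψ) (p : M) :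
    S.dot Ψ p * S.Ω p = S.hat Ψ p * S.ξ p := by
  obtain ⟨v, w, hv, hw, hvw⟩ := S.exists_eps_ne_zero p
  obtain ⟨X, hX, rfl, hXs⟩ := S.exists_sheet_field hv
  obtain ⟨Y, hY, rfl, hYs⟩ := S.exists_sheet_field hw
  have h := S.dirDeriv_commutator hΨ hX hY
  have hX0 : (fun q ↦ dirDeriv Ψ q (X q)) = fun _ ↦ 0 :=
    funext fun q ↦ hΨ.2 q _ (hXs q).1 (hXs q).2
  have hY0 : (fun q ↦ dirDeriv Ψ q (Y q)) = fun _ ↦ 0 :=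
    funext fun q ↦ hΨ.2 q _ (hYs q).1 (hYs q).2
  have hu := S.smooth_u.diffAt p
  have he := S.smooth_e.diffAt p
  rw [hX0, hY0, dirDeriv_const, dirDeriv_const,
    S.metric_orthogonal hu hX (fun q ↦ (hXs q).1), S.metric_orthogonal hu hY (fun q ↦ (hYs q).1),
    S.metric_orthogonal he hX (fun q ↦ (hXs q).2), S.metric_orthogonal he hY (fun q ↦ (hYs q).2),
    S.nab_u, S.nab_u, S.nab_e, S.nab_e, hv.1, hv.2, hw.1, hw.2, S.lorentz.symm p (Y p) (X p),
    S.eps_antisymm p (Y p) (X p)] at h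
  refine mul_left_cancel₀ hvw ?_
  linear_combination -h / 2

/-- For a sheet field `X`, the LRS form of `∇u` and `∇e` makes `[X, u]` tangent to the sheet at the
point, so `X(uΨ) = u(XΨ) = 0`. -/
lemma IsScalar.dot {Ψ : M → ℝ} (hΨ : S.IsScalar Ψ) : S.IsScalar (S.dot Ψ) := by
  refine ⟨contMDiff_dirDeriv hΨ.1 S.smooth_u, fun p v hv1 hv2 ↦ ?_⟩
  obtain ⟨X, hX, rfl, hXs⟩ := S.exists_sheet_field ⟨hv1, hv2⟩
  have hu := S.smooth_u.diffAt p
  have he := S.smooth_e.diffAt p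
  have h := S.dirDeriv_commutator hΨ hX hu
  have hX0 : (fun q ↦ dirDeriv Ψ q (X q)) = fun _ ↦ 0 :=
    funext fun q ↦ hΨ.2 q _ (hXs q).1 (hXs q).2
  rw [hX0, dirDeriv_const, S.metric_orthogonal hu hX (fun q ↦ (hXs q).1),
    S.metric_orthogonal he hX (fun q ↦ (hXs q).2), S.lorentz.symm p _ (S.nab S.u p _),
    S.lorentz.symm p _ (S.nab S.u p _), S.nab_u, S.nab_u, S.nab_u, S.nab_e, S.eps_self_u,
    S.eps_self_e, S.eps_u, S.lorentz.symm p (X p), S.lorentz.symm p (X p), hv1, hv2] at h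
  change dirDeriv (fun q ↦ dirDeriv Ψ q (S.u q)) p (X p) = 0
  linear_combination h

lemma IsScalar.hat {Ψ : M → ℝ} (hΨ : S.IsScalar Ψ) : S.IsScalar (S.hat Ψ) := by
  refine ⟨contMDiff_dirDeriv hΨ.1 S.smooth_e, fun p v hv1 hv2 ↦ ?_⟩
  obtain ⟨X, hX, rfl, hXs⟩ := S.exists_sheet_field ⟨hv1, hv2⟩
  have hu := S.smooth_u.diffAt p
  have he := S.smooth_e.diffAt p
  have h := S.dirDeriv_commutator hΨ hX he
  have hX0 : (fun q ↦ dirDeriv Ψ q (X q)) = fun _ ↦ 0 :=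
    funext fun q ↦ hΨ.2 q _ (hXs q).1 (hXs q).2
  rw [hX0, dirDeriv_const, S.metric_orthogonal hu hX (fun q ↦ (hXs q).1),
    S.metric_orthogonal he hX (fun q ↦ (hXs q).2), S.lorentz.symm p _ (S.nab S.e p _),
    S.lorentz.symm p _ (S.nab S.e p _), S.nab_u, S.nab_e, S.nab_e, S.nab_e, S.eps_self_u,
    S.eps_self_e, S.eps_e, S.lorentz.symm p (X p), S.lorentz.symm p (X p), hv1, hv2] at h
  change dirDeriv (fun q ↦ dirDeriv Ψ q (S.e q)) p (X p) = 0
  linear_combination h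

end LRSSpacetime

/-! ### Curve parameters, constancy of `Ω/ξ`, and Euler's relation. -/

namespace LRSSpacetime

variable {M : Type*} [TopologicalSpace M] [ChartedSpace (EuclideanSpace ℝ (Fin 4)) M]
  [IsManifold (𝓡 4) ∞ M] {S : LRSSpacetime M}

/-- The ratio of rotation and twist is an LRS scalar. -/
lemma RotatingTwisting.isScalar_ratio (hS : S.RotatingTwisting) :
    S.IsScalar fun p ↦ S.Ω p / S.ξ p := by
  have hξ (p : M) : S.ξ p ≠ 0 := right_ne_zero_of_mul (hS p)
  have hr : ContMDiff (𝓡 4) 𝓘(ℝ, ℝ) ∞ fun p ↦ S.Ω p / S.ξ p :=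
    S.isScalar_Ω.1.div₀ S.isScalar_ξ.1 hξ
  refine ⟨hr, fun p v hu he ↦ ?_⟩
  have h := dirDeriv_mul (ContMDiff.mdiffAt hr p) (S.isScalar_ξ.mdiffAt p) v
  rw [funext fun q ↦ div_mul_cancel₀ (S.Ω q) (hξ q), S.isScalar_Ω.2 p v hu he,
    S.isScalar_ξ.2 p v hu he, mul_zero, zero_add, eq_comm] at h
  exact (mul_eq_zero.1 h).resolve_right (hξ p)

lemma RotatingTwisting.hat_eq (hS : S.RotatingTwisting) {Ψ : M → ℝ} (hΨ : S.IsScalar Ψ) (p : M) :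
    S.hat Ψ p = S.Ω p / S.ξ p * S.dot Ψ p := by
  have := right_ne_zero_of_mul (hS p)
  field_simp
  linear_combination -hΨ.dot_mul_Ω p

namespace AreCurveParameters

variable {τ ρ : M → ℝ} (h : S.AreCurveParameters τ ρ)

include h

lemma dirDeriv_eq {Ψ : M → ℝ} (hΨ : S.IsScalar Ψ) (p : M) (v : T p) :
    dirDeriv Ψ p v = S.dot Ψ p * dirDeriv τ p v + S.hat Ψ p * dirDeriv ρ p v := by
  obtain ⟨ψ, hψ⟩ := h.scalar Ψ hΨ p
  rw [dirDeriv_comp_prod hψ.self_of_nhds.2 (ContMDiff.mdiffAt h.smooth_τ p)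
    (ContMDiff.mdiffAt h.smooth_ρ p) (hΨ.mdiffAt p) (hψ.mono fun q hq ↦ hq.1) v]
  simp

/-- Second derivatives with respect to the curve parameters commute. -/
lemma hat_dot {Ψ : M → ℝ} (hΨ : S.IsScalar Ψ) (p : M) :
    S.hat (S.dot Ψ) p = S.dot (S.hat Ψ) p := by
  -- The identity is `d(dΨ) = 0` for `dΨ = Ψ̇ dτ + Ψ̂ dρ`, evaluated on fields dual to `dτ`, `dρ` at
  -- `p`; the bracket terms of `τ` and `ρ` cancel.
  obtain ⟨v, hv1, hv2⟩ := h.independent p 1 0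
  obtain ⟨w, hw1, hw2⟩ := h.independent p 0 1
  have hext (x : T p) : ∃ X : VField M, X.DiffAt p ∧ X p = x :=
    ⟨FiberBundle.extend (EuclideanSpace ℝ (Fin 4)) x,
      FiberBundle.mdifferentiableAt_extend (𝓡 4) (EuclideanSpace ℝ (Fin 4)) x, by simp⟩
  obtain ⟨X, hX, rfl⟩ := hext v
  obtain ⟨Y, hY, rfl⟩ := hext w
  have key {Z : VField M} (hZ : Z.DiffAt p) (x : T p) :
      dirDeriv (fun q ↦ dirDeriv Ψ q (Z q)) p x =
        S.dot Ψ p * dirDeriv (fun q ↦ dirDeriv τ q (Z q)) p x +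
            dirDeriv (S.dot Ψ) p x * dirDeriv τ p (Z p) +
          (S.hat Ψ p * dirDeriv (fun q ↦ dirDeriv ρ q (Z q)) p x +
            dirDeriv (S.hat Ψ) p x * dirDeriv ρ p (Z p)) := by
    have h1 := mdifferentiableAt_dirDeriv h.smooth_τ hZ
    have h2 := mdifferentiableAt_dirDeriv h.smooth_ρ hZ
    rw [funext fun q ↦ h.dirDeriv_eq hΨ q (Z q),
      dirDeriv_add (f := fun q ↦ S.dot Ψ q * dirDeriv τ q (Z q))
        (h := fun q ↦ S.hat Ψ q * dirDeriv ρ q (Z q))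
        ((hΨ.dot.mdiffAt p).mul h1) ((hΨ.hat.mdiffAt p).mul h2),
      dirDeriv_mul (hΨ.dot.mdiffAt p) h1, dirDeriv_mul (hΨ.hat.mdiffAt p) h2]
  have e1 := dirDeriv_mlieBracket hΨ.1 hX hY
  have e2 := dirDeriv_mlieBracket h.smooth_τ hX hY
  have e3 := dirDeriv_mlieBracket h.smooth_ρ hX hY
  rw [h.dirDeriv_eq hΨ, key hX, key hY, e2, e3, h.dirDeriv_eq hΨ.dot, h.dirDeriv_eq hΨ.dot,
    h.dirDeriv_eq hΨ.hat, h.dirDeriv_eq hΨ.hat, hv1, hv2, hw1, hw2] at e1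
  linear_combination e1

/-- The ratio of rotation and twist is constant. -/
lemma exists_ratio [ConnectedSpace M] (hS : S.RotatingTwisting) :
    ∃ r : ℝ, r ≠ 0 ∧ (∀ p, S.Ω p = r * S.ξ p) ∧
      ∀ Ψ : M → ℝ, S.IsScalar Ψ → ∀ p, S.hat Ψ p = r * S.dot Ψ p := by
  have hr := hS.isScalar_ratio
  set R : M → ℝ := fun p ↦ S.Ω p / S.ξ p with hR
  have hhat {Ψ : M → ℝ} (hΨ : S.IsScalar Ψ) (p : M) : S.hat Ψ p = R p * S.dot Ψ p :=
    hS.hat_eq hΨ p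
  -- The two orders of differentiating `R` differ exactly by the product-rule term `Ṙ²`.
  have hdot (p : M) : S.dot R p = 0 := by
    have h1 := h.hat_dot hr p
    have h2 : S.dot (S.hat R) p = R p * S.dot (S.dot R) p + S.dot R p * S.dot R p := by
      rw [funext (hhat hr)]
      exact dirDeriv_mul (hr.mdiffAt p) (hr.dot.mdiffAt p) (S.u p)
    rw [hhat hr.dot] at h1
    exact mul_self_eq_zero.1 (by linear_combination -h1 - h2)
  obtain ⟨r, hrc⟩ := exists_eq_const_of_dirDeriv_eq_zero (fun p ↦ hr.mdiffAt p) fun p v ↦ by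
    rw [h.dirDeriv_eq hr, hhat hr, hdot]; ring
  refine ⟨r, ?_, fun p ↦ ?_, fun Ψ hΨ p ↦ hrc p ▸ hhat hΨ p⟩
  · obtain ⟨p⟩ : Nonempty M := inferInstance
    rw [← hrc p]
    exact div_ne_zero (left_ne_zero_of_mul (hS p)) (right_ne_zero_of_mul (hS p))
  · rw [← hrc p, hR, div_mul_cancel₀ _ (right_ne_zero_of_mul (hS p))]

/-- The curve parameters form an open map to the plane. -/
lemma eventually_exists {P : M → Prop} {p : M} (hP : ∀ᶠ q in 𝓝 p, P q) :
    ∀ᶠ y in 𝓝 (τ p, ρ p), ∃ q, P q ∧ (τ q, ρ q) = y := by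
  let φ := extChartAt (𝓡 4) p
  let G : EuclideanSpace ℝ (Fin 4) → ℝ × ℝ := fun x ↦ ((τ ∘ φ.symm) x, (ρ ∘ φ.symm) x)
  have hτ := ((ContMDiff.contDiffAt_chart h.smooth_τ p).hasStrictFDerivAt (by simp))
  have hρ := ((ContMDiff.contDiffAt_chart h.smooth_ρ p).hasStrictFDerivAt (by simp))
  have hG := hτ.prodMk hρ
  have hmap := hG.map_nhds_eq_of_surj (by
    refine LinearMap.range_eq_top.2 fun y ↦ ?_
    obtain ⟨v, hv1, hv2⟩ := h.independent p y.1 y.2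
    rw [dirDeriv_eq_fderiv (ContMDiff.mdiffAt h.smooth_τ p)] at hv1
    rw [dirDeriv_eq_fderiv (ContMDiff.mdiffAt h.smooth_ρ p)] at hv2
    exact ⟨v, Prod.ext hv1 hv2⟩)
  have hc : Filter.Tendsto φ.symm (𝓝 (φ p)) (𝓝 p) := by
    simpa [ContinuousAt, φ] using continuousAt_extChartAt_symm (I := 𝓡 4) p
  have := Filter.image_mem_map (m := G) (hc.eventually hP)
  have hGp : G (φ p) = (τ p, ρ p) := by simp [G, φ]
  rw [show Filter.map G (𝓝 (φ p)) = 𝓝 (τ p, ρ p) from hmap.trans (congrArg 𝓝 hGp)] at this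
  filter_upwards [this] with y hy
  obtain ⟨x, hx, rfl⟩ := hy
  exact ⟨φ.symm x, hx, rfl⟩

/-- Euler's relation for scalars of a given weight. -/
lemma euler {Ψ : M → ℝ} {n : ℝ} (hΨ : S.HasWeight τ ρ n Ψ) (p : M) :
    τ p * S.dot Ψ p + ρ p * S.hat Ψ p = -n * Ψ p := by
  obtain ⟨ψ, hψ⟩ := h.scalar Ψ hΨ.1 p
  have hline : HasDerivAt (fun a : ℝ ↦ (a * τ p, a * ρ p)) (τ p, ρ p) 1 := by
    simpa using ((hasDerivAt_id (1 : ℝ)).mul_const (τ p)).prodMk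
      ((hasDerivAt_id (1 : ℝ)).mul_const (ρ p))
  have hc : Filter.Tendsto (fun a : ℝ ↦ (a * τ p, a * ρ p)) (𝓝 1) (𝓝 (τ p, ρ p)) := by
    simpa [ContinuousAt] using hline.continuousAt
  -- Scaling compares points of `M`; openness of `(τ, ρ)` supplies a point near `p` with rescaled
  -- parameters for each `a` near `1`.
  have hconst : (fun a : ℝ ↦ a ^ n * ψ (a * τ p, a * ρ p)) =ᶠ[𝓝 1] fun _ ↦ Ψ p := by
    filter_upwards [hc.eventually (h.eventually_exists hψ), lt_mem_nhds one_pos] with a ha ha0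
    obtain ⟨q, hq, hqa⟩ := ha
    rw [hΨ.2 a ha0 p q (Prod.ext_iff.1 hqa).1 (Prod.ext_iff.1 hqa).2, ← hqa, hq.1]
  have hψp : HasFDerivAt ψ (S.dot Ψ p • ContinuousLinearMap.fst ℝ ℝ ℝ +
      S.hat Ψ p • ContinuousLinearMap.snd ℝ ℝ ℝ) (1 * τ p, 1 * ρ p) := by
    simpa using hψ.self_of_nhds.2
  have hd := (Real.hasDerivAt_rpow_const (x := 1) (p := n) (Or.inl one_ne_zero)).mul
    (hψp.comp_hasDerivAt (1 : ℝ) hline)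
  have h0 := hd.unique ((hasDerivAt_const (1 : ℝ) (Ψ p)).congr_of_eventuallyEq hconst)
  simp [← hψ.self_of_nhds.1] at h0
  linear_combination h0

end AreCurveParameters

/-! ### Integrating the Euler equation in `w = τ + rρ`. -/

section Weights

variable {τ ρ : M → ℝ} (h : S.AreCurveParameters τ ρ) {r : ℝ}
  (hr : ∀ Ψ : M → ℝ, S.IsScalar Ψ → ∀ p, S.hat Ψ p = r * S.dot Ψ p)

namespace AreCurveParameters

include h

lemma mdiffAt_combination (r : ℝ) (p : M) :
    MDifferentiableAt (𝓡 4) 𝓘(ℝ, ℝ) (fun q ↦ τ q + r * ρ q) p :=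
  (ContMDiff.mdiffAt h.smooth_τ p).add
    (mdifferentiableAt_const.mul (ContMDiff.mdiffAt h.smooth_ρ p))

lemma dirDeriv_combination (r : ℝ) (p : M) (v : T p) :
    dirDeriv (fun q ↦ τ q + r * ρ q) p v = dirDeriv τ p v + r * dirDeriv ρ p v := by
  have hρ := ContMDiff.mdiffAt h.smooth_ρ p
  rw [dirDeriv_add (h := fun q ↦ r * ρ q) (ContMDiff.mdiffAt h.smooth_τ p)
      (mdifferentiableAt_const.mul hρ),
    dirDeriv_mul mdifferentiableAt_const hρ, dirDeriv_const]
  ring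

/-- Since `dw` vanishes nowhere, the zero set of `w` has empty interior. -/
lemma not_eventually_combination_eq_zero (r : ℝ) (p : M) :
    ¬ ∀ᶠ q in 𝓝 p, τ q + r * ρ q = 0 := by
  intro H
  obtain ⟨v, hv1, hv2⟩ := h.independent p 1 0
  have h1 := h.dirDeriv_combination r p v
  rw [dirDeriv_congr (h := fun _ ↦ 0) H, dirDeriv_const, hv1, hv2] at h1
  norm_num at h1

include hr

lemma dirDeriv_eq_dot_mul {Ψ : M → ℝ} (hΨ : S.IsScalar Ψ) (p : M) (v : T p) :
    dirDeriv Ψ p v = S.dot Ψ p * dirDeriv (fun q ↦ τ q + r * ρ q) p v := by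
  rw [h.dirDeriv_combination, h.dirDeriv_eq hΨ, hr Ψ hΨ]
  ring

lemma euler_combination {Ψ : M → ℝ} {n : ℝ} (hΨ : S.HasWeight τ ρ n Ψ) (p : M) :
    (τ p + r * ρ p) * S.dot Ψ p = -n * Ψ p := by
  rw [← h.euler hΨ p, hr Ψ hΨ.1]
  ring

variable [ConnectedSpace M]

/-- Differentiating `w Ψ̇ = mΨ` yields the same equation for `Ψ̇` with `m - 1`. This descent gives
one constant even across zeros of `w`, where dividing by `w ^ m` could give different constants on
the two sides. -/
lemma exists_eq_mul_pow (m : ℕ) {Ψ : M → ℝ} (hΨ : S.IsScalar Ψ)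
    (hm : ∀ p, (τ p + r * ρ p) * S.dot Ψ p = m * Ψ p) :
    ∃ c : ℝ, ∀ p, Ψ p = c * (τ p + r * ρ p) ^ m := by
  induction m generalizing Ψ with
  | zero =>
    have hdot (p : M) : S.dot Ψ p = 0 := by
      by_contra hp
      refine h.not_eventually_combination_eq_zero r p ?_
      filter_upwards [hΨ.dot.1.continuous.continuousAt.eventually_ne hp] with q hq
      simpa [hq] using hm q
    obtain ⟨c, hc⟩ := exists_eq_const_of_dirDeriv_eq_zero (fun p ↦ hΨ.mdiffAt p) fun p v ↦ by
      rw [h.dirDeriv_eq_dot_mul hr hΨ, hdot, zero_mul]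
    exact ⟨c, fun p ↦ by simp [hc]⟩
  | succ m ih =>
    have hstep (p : M) : (τ p + r * ρ p) * S.dot (S.dot Ψ) p = m * S.dot Ψ p := by
      have h1 := dirDeriv_mul (h.mdiffAt_combination r p) (hΨ.dot.mdiffAt p) (S.u p)
      have h2 := dirDeriv_mul (mdifferentiableAt_const (c := ((m + 1 : ℕ) : ℝ)))
        (hΨ.mdiffAt p) (S.u p)
      rw [dirDeriv_const] at h2
      rw [funext hm, h2] at h1
      -- `dw(u) = 1` is not available where all scalars are stationary, but its product with `Ψ̇`
      -- suffices.
      have h3 : S.dot Ψ p = S.dot Ψ p * dirDeriv (fun q ↦ τ q + r * ρ q) p (S.u p) :=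
        h.dirDeriv_eq_dot_mul hr hΨ p (S.u p)
      change _ * S.dot Ψ p + _ = _ * S.dot (S.dot Ψ) p + _ at h1
      push_cast at h1
      linear_combination -h1 + h3
    obtain ⟨c, hc⟩ := ih hΨ.dot hstep
    refine ⟨c / (m + 1), fun p ↦ ?_⟩
    have h1 := hm p
    have hm0 : (m + 1 : ℝ) ≠ 0 := by positivity
    rw [hc] at h1
    push_cast at h1
    field_simp
    linear_combination -h1

lemma exists_eq_const {Ψ : M → ℝ} (hΨ : S.HasWeight τ ρ 0 Ψ) : ∃ c : ℝ, ∀ p, Ψ p = c := by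
  obtain ⟨c, hc⟩ := h.exists_eq_mul_pow hr 0 hΨ.1 fun p ↦ by
    rw [h.euler_combination hr hΨ]; simp
  exact ⟨c, fun p ↦ by simpa using hc p⟩

lemma exists_mul_pow_eq (m : ℕ) {Ψ : M → ℝ} (hΨ : S.HasWeight τ ρ (m + 1 : ℕ) Ψ) :
    ∃ c : ℝ, ∀ p, Ψ p * (τ p + r * ρ p) ^ (m + 1) = c := by
  have hd (p : M) : MDifferentiableAt (𝓡 4) 𝓘(ℝ, ℝ) (fun q ↦ (τ q + r * ρ q) ^ (m + 1)) p :=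
    (h.mdiffAt_combination r p).pow _
  refine exists_eq_const_of_dirDeriv_eq_zero (fun p ↦ (hΨ.1.mdiffAt p).mul (hd p)) fun p v ↦ ?_
  have he := h.euler_combination hr hΨ p
  rw [dirDeriv_mul (hΨ.1.mdiffAt p) (hd p), h.dirDeriv_eq_dot_mul hr hΨ.1,
    dirDeriv_comp (F := fun x ↦ x ^ (m + 1)) (hasDerivAt_pow (m + 1) _)
      (h.mdiffAt_combination r p)]
  rw [Nat.add_sub_cancel]
  push_cast at he ⊢
  linear_combination (τ p + r * ρ p) ^ m * dirDeriv (fun q ↦ τ q + r * ρ q) p v * he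

lemma exists_eq_div_zpow (n : ℤ) {Ψ : M → ℝ} (hΨ : S.HasWeight τ ρ n Ψ) :
    ∃ c : ℝ, ∀ p, Ψ p = c / (τ p + r * ρ p) ^ n := by
  have he := h.euler_combination hr hΨ
  obtain ⟨m, rfl | rfl⟩ := n.eq_nat_or_neg
  · rcases m with _ | m
    · obtain ⟨c, hc⟩ := h.exists_eq_const hr (by simpa using hΨ)
      exact ⟨c, fun p ↦ by simp [hc]⟩
    · obtain ⟨c, hc⟩ := h.exists_mul_pow_eq hr m hΨ
      refine ⟨c, fun p ↦ ?_⟩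
      rw [zpow_natCast, ← hc p]
      -- Where `w = 0`, the Euler equation forces `Ψ = 0`, in agreement with division by zero being
      -- `0`.
      rcases eq_or_ne (τ p + r * ρ p) 0 with h0 | h0
      · have := he p
        rw [h0, zero_mul, eq_comm, mul_eq_zero, neg_eq_zero] at this
        rw [this.resolve_left (by exact_mod_cast m.succ_ne_zero)]
        simp
      · rw [mul_div_cancel_right₀ _ (pow_ne_zero _ h0)]
  · obtain ⟨c, hc⟩ := h.exists_eq_mul_pow hr m hΨ.1 fun p ↦ by rw [he]; simp
    exact ⟨c, fun p ↦ by rw [hc, zpow_neg, zpow_natCast, div_inv_eq_mul]⟩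

/-- If some nowhere vanishing scalar has weight one, it is an inverse multiple of `τ + r ρ`. -/
lemma exists_mul_eq_of_weight_one {Ψ : M → ℝ} (hΨ : S.HasWeight τ ρ 1 Ψ) (h0 : ∀ p, Ψ p ≠ 0) :
    ∃ D : ℝ, D ≠ 0 ∧ ∀ p, Ψ p * (τ p + r * ρ p) = D := by
  obtain ⟨D, hD⟩ := h.exists_mul_pow_eq hr 0 (by simpa using hΨ)
  simp only [zero_add, pow_one] at hD
  refine ⟨D, ?_, hD⟩
  rintro rfl
  obtain ⟨p⟩ : Nonempty M := inferInstance
  exact h.not_eventually_combination_eq_zero r p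
    (Filter.Eventually.of_forall fun q ↦ (mul_eq_zero.1 (hD q)).resolve_left (h0 q))

lemma exists_eq_div_abs_rpow (n : ℝ) {Ψ : M → ℝ} (hΨ : S.HasWeight τ ρ n Ψ)
    (hw : ∀ p, τ p + r * ρ p ≠ 0) : ∃ c : ℝ, ∀ p, Ψ p = c / |τ p + r * ρ p| ^ n := by
  -- As `Real.log x = log |x|`, this function is `|x| ^ n` for `x ≠ 0`, with no case split on the
  -- sign.
  have hF (p : M) : HasDerivAt (fun x ↦ Real.exp (Real.log x * n))
      (Real.exp (Real.log (τ p + r * ρ p) * n) * ((τ p + r * ρ p)⁻¹ * n)) (τ p + r * ρ p) :=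
    ((Real.hasDerivAt_log (hw p)).mul_const n).exp
  have hd (p : M) : MDifferentiableAt (𝓡 4) 𝓘(ℝ, ℝ)
      (fun q ↦ Real.exp (Real.log (τ q + r * ρ q) * n)) p :=
    MDifferentiableAt.comp (g := fun x ↦ Real.exp (Real.log x * n)) p
      (hF p).differentiableAt.mdifferentiableAt
      (h.mdiffAt_combination r p)
  obtain ⟨c, hc⟩ := exists_eq_const_of_dirDeriv_eq_zero
    (fun p ↦ (hΨ.1.mdiffAt p).mul (hd p)) fun p v ↦ by
      have he := h.euler_combination hr hΨ p
      change dirDeriv (fun q ↦ Ψ q * Real.exp (Real.log (τ q + r * ρ q) * n)) p v = 0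
      rw [dirDeriv_mul (hΨ.1.mdiffAt p) (hd p), h.dirDeriv_eq_dot_mul hr hΨ.1,
        dirDeriv_comp (f := fun q ↦ τ q + r * ρ q) (hF p) (h.mdiffAt_combination r p)]
      have := hw p
      field_simp
      linear_combination Real.exp (Real.log (τ p + r * ρ p) * n) *
        dirDeriv (fun q ↦ τ q + r * ρ q) p v * he
  refine ⟨c, fun p ↦ ?_⟩
  rw [Real.rpow_def_of_pos (abs_pos.2 (hw p)), Real.log_abs, eq_div_iff (Real.exp_ne_zero _)]
  exact hc p

end AreCurveParameters

end Weights

end LRSSpacetime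
end LRS

/-! ### Assembly in terms of `z = τ/ρ`. -/

theorem mainTheorem2 {M : Type*} [TopologicalSpace M]
    [ChartedSpace (EuclideanSpace ℝ (Fin 4)) M] [IsManifold (𝓡 4) ∞ M]
    [T2Space M] [ConnectedSpace M]
    (S : LRS.LRSSpacetime M) (hS : S.RotatingTwisting) :
    (∀ Ψ : M → ℝ, S.IsScalar Ψ → ∀ p, S.dot Ψ p * S.Ω p = S.hat Ψ p * S.ξ p) ∧
    ∀ τ ρ : M → ℝ, S.AreCurveParameters τ ρ → (∀ p, ρ p ≠ 0) →
      (∀ Ψ : M → ℝ, S.HasWeight τ ρ 0 Ψ → ∃ c : ℝ, ∀ p, Ψ p = c) ∧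
      ∃ A B : ℝ, A ≠ 0 ∧ B ≠ 0 ∧
        (∀ p, A * S.Ω p = B * S.ξ p) ∧
        (∀ (n : ℤ) (Ψ : M → ℝ), S.HasWeight τ ρ n Ψ →
          ∃ C : ℝ, ∀ p, Ψ p = C / ((A * (τ p / ρ p) + B) ^ n * ρ p ^ n)) ∧
        (S.HasWeight τ ρ 1 S.Ω → S.HasWeight τ ρ 1 S.ξ →
          (∀ p, A * (τ p / ρ p) + B ≠ 0) ∧
          (∀ p, S.ξ p = -1 / (A * (τ p / ρ p) + B) / ρ p) ∧
          (∀ p, S.Ω p = -B / (A * (A * (τ p / ρ p) + B)) / ρ p) ∧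
          (∀ (n : ℝ) (Ψ : M → ℝ), S.HasWeight τ ρ n Ψ →
            ∃ C : ℝ, ∀ p, Ψ p = C / (|A * (τ p / ρ p) + B| ^ n * |ρ p| ^ n))) := by
  refine ⟨fun Ψ hΨ ↦ hΨ.dot_mul_Ω, fun τ ρ h hρ ↦ ?_⟩
  obtain ⟨r, hr0, hΩ, hr⟩ := h.exists_ratio hS
  refine ⟨fun Ψ hΨ ↦ h.exists_eq_const hr hΨ, ?_⟩
  have hfac (A : ℝ) (p : M) : (A * (τ p / ρ p) + r * A) * ρ p = A * (τ p + r * ρ p) := by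
    have := hρ p
    field_simp
  have hint (A : ℝ) (hA : A ≠ 0) (n : ℤ) (Ψ : M → ℝ) (hΨ : S.HasWeight τ ρ n Ψ) :
      ∃ C : ℝ, ∀ p, Ψ p = C / ((A * (τ p / ρ p) + r * A) ^ n * ρ p ^ n) := by
    obtain ⟨c, hc⟩ := h.exists_eq_div_zpow hr n hΨ
    refine ⟨A ^ n * c, fun p ↦ ?_⟩
    rw [← mul_zpow, hfac, mul_zpow, mul_div_mul_left _ _ (zpow_ne_zero n hA), hc]
  -- The integer-weight formula allows any `A ≠ 0` with `B = rA`. If `ξ` has weight one, `ξ w = D`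
  -- fixes the normalisation `A = -1/D`; otherwise `A = 1` serves.
  by_cases hξ : S.HasWeight τ ρ 1 S.ξ
  · obtain ⟨D, hD0, hD⟩ := h.exists_mul_eq_of_weight_one hr hξ fun p ↦ right_ne_zero_of_mul (hS p)
    have hw (p : M) : τ p + r * ρ p ≠ 0 := right_ne_zero_of_mul (hD p ▸ hD0)
    have hA : -D⁻¹ ≠ 0 := neg_ne_zero.2 (inv_ne_zero hD0)
    have hne (p : M) : -D⁻¹ * (τ p / ρ p) + r * -D⁻¹ ≠ 0 :=
      left_ne_zero_of_mul (b := ρ p) (hfac _ p ▸ mul_ne_zero hA (hw p))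
    have hξeq (p : M) : S.ξ p = -1 / (-D⁻¹ * (τ p / ρ p) + r * -D⁻¹) / ρ p := by
      rw [div_div, hfac, eq_div_iff (mul_ne_zero hA (hw p))]
      linear_combination (-D⁻¹) * hD p - inv_mul_cancel₀ hD0
    refine ⟨-D⁻¹, r * -D⁻¹, hA, mul_ne_zero hr0 hA, fun p ↦ ?_, hint _ hA, fun _ _ ↦
      ⟨hne, hξeq, fun p ↦ ?_, fun n Ψ hΨ ↦ ?_⟩⟩
    · rw [hΩ]; ring
    · rw [hΩ, hξeq, neg_mul_eq_neg_mul, mul_comm (-r), mul_div_mul_left _ _ hA]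
      ring
    · obtain ⟨c, hc⟩ := h.exists_eq_div_abs_rpow hr n hΨ hw
      refine ⟨|-D⁻¹| ^ n * c, fun p ↦ ?_⟩
      rw [← Real.mul_rpow (abs_nonneg _) (abs_nonneg _), ← abs_mul, hfac, abs_mul,
        Real.mul_rpow (abs_nonneg _) (abs_nonneg _),
        mul_div_mul_left _ _ (Real.rpow_pos_of_pos (abs_pos.2 hA) n).ne', hc]
  · refine ⟨1, r * 1, one_ne_zero, by simpa using hr0, fun p ↦ ?_, hint 1 one_ne_zero,
      fun _ h1 ↦ absurd h1 hξ⟩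
    rw [hΩ]; ring
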